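/- All groups are finite. For $k\in\mathbb N$, a colored group is a group $G$ with a map $\gamma:G\to\mathcal C$; an uncolored group is one in which all elements have the same color. The coloring of $k$-WL$_{\mathrm I}$ on $G^k$ is defined in rounds. In round $0$ the color of $\bar g=(g_1,\dots,g_k)$ records the colors $\gamma(g_i)$, for which $i,j$ one has $g_i=g_j$, and for which $i,j,m$ one has $g_ig_j=g_m$. In round $n+1$ the color of $\bar g$ is its color in round $n$ together with the multiset, over all $x\in G$, of the $k$-tuples whose $j$-th entry is the round-$n$ color of the tuple obtained from $\bar g$ by replacing $g_j$ by $x$. Two $k$-tuples, of the same or of different colored groups, have the same stable color, $\chi_\gamma(\bar g)=\chi_\delta(\bar h)$, if their colors agree in every round. The color of an element is $\chi_\gamma(x):=\chi_\gamma(x,1,\dots,1)$. For uncolored groups (with the same single color), write $G\equiv^{\mathrm I}_kH$ if there is a bijection $f:G^k\to H^k$ such that $\bar g$ and $f(\bar g)$ have the same stable color for all $\bar g\in G^k$. A rule $\mathcal S$ assigning to every colored group $(G,\gamma)$ a subset $\mathcal S(G,\gamma)\subseteq G$ is $k$-WL$_{\mathrm I}$-detectable if $$\chi_\gamma(\mathcal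 S(G,\gamma))\cap\chi_\delta(H\setminus\mathcal S(H,\delta))=\emptyset$$ for all colored groups $(G,\gamma)$ and $(H,\delta)$. The upper central series is given by $Z^0(G)=\{1\}$ and $Z^{i+1}(G)/Z^i(G)=Z(G/Z^i(G))$. Let $k\ge 4$. Then for every $i\ge 0$ the rule $(G,\gamma)\mapsto Z^i(G)$ is $k$-WL$_{\mathrm I}$-detectable. If moreover $G$ and $H$ are finite groups with $G\equiv^{\mathrm I}_kH$, then for all $i\ge 0$ $$Z^{i+1}(G)/Z^i(G)\cong Z^{i+1}(H)/Z^i(H),\qquad Z^i(G)\equiv^{\mathrm I}_kZ^i(H),\qquad G/Z^i(G)\equiv^{\mathrm I}_kH/Z^i(H).$$ -/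

import Mathlib

/-!  Weisfeiler-Leman refinement (Version I) on finite colored groups. An element-coloring of `G`
is a map `γ : G → C`; colors of different groups are comparable when they lie in the same `C`. -/

universe u v w

namespace GroupWL

/-- The type of colors used by the `k`-dimensional refinement after `n` rounds, for element-colors
in `C`. An initial color records the element-colors of the entries of a tuple, the equalities
between entries and the products among entries; a color of round `n + 1` is a color of round `n`
together with a multiset of `k`-tuples of colors of round `n`. -/
def Color (k : ℕ) (C : Type w) : ℕ → Type w
  | 0 => (Fin k → C) × (Fin k → Fin k → Prop) × (Fin k → Fin k → Fin k → Prop)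
  | n + 1 => Color k C n × Multiset (Fin k → Color k C n)

/-- The color of a `k`-tuple after `n` rounds of `k`-WL of Version I on the finite colored group
`(G, γ)`. -/
noncomputable def color {G : Type u} [Group G] [Finite G] {C : Type w} {k : ℕ} (γ : G → C) :
    (n : ℕ) → (Fin k → G) → Color k C n
  | 0, g => (fun i => γ (g i), fun i j => g i = g j, fun i j m => g i * g j = g m)
  | n + 1, g =>
      (color γ n g,
        (@Finset.univ G (Fintype.ofFinite G)).val.map
          fun x j => color γ n (Function.update g j x))

/-- The stable color of a `k`-tuple, recorded as the sequence of its colors in all rounds. Two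
tuples, of one group or of two groups, have the same stable color iff no round separates them; on
a single group this is the partition at which the refinement stabilizes. -/
noncomputable def stableColor {G : Type u} [Group G] [Finite G] {C : Type w} {k : ℕ} (γ : G → C)
    (g : Fin k → G) : (n : ℕ) → Color k C n :=
  fun n => color γ n g

/-- Once a round does not refine the partition of `G^k`, the classes of the stable coloring are
the classes reached so far. -/
theorem stableColor_eq_iff {G : Type u} [Group G] [Finite G] {C : Type w} {k : ℕ} (γ : G → C)
    (n : ℕ)
    (hn : ∀ a b : Fin k → G, color γ n a = color γ n b → color γ (n + 1) a = color γ (n + 1) b)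
    (g h : Fin k → G) : stableColor γ g = stableColor γ h ↔ color γ n g = color γ n h := by
  have down : ∀ (m : ℕ) (a b : Fin k → G),
      color γ (m + 1) a = color γ (m + 1) b → color γ m a = color γ m b := by
    intro m a b hab
    simp only [color] at hab
    exact (Prod.mk.inj hab).1
  have step : ∀ m, (∀ a b : Fin k → G, color γ m a = color γ m b →
      color γ (m + 1) a = color γ (m + 1) b) → ∀ a b : Fin k → G,
      color γ (m + 1) a = color γ (m + 1) b → color γ (m + 2) a = color γ (m + 2) b := by
    intro m hm a b hab
    classical
    have hφ : ∃ φ : Color k C m → Color k C (m + 1), ∀ a : Fin k → G,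
        φ (color γ m a) = color γ (m + 1) a :=
      ⟨fun c => if hc : ∃ a : Fin k → G, color γ m a = c then color γ (m + 1) hc.choose
        else (c, 0), fun a => by
        have hc : ∃ b : Fin k → G, color γ m b = color γ m a := ⟨a, rfl⟩
        exact (dif_pos hc).trans (hm _ _ hc.choose_spec)⟩
    obtain ⟨φ, hφ⟩ := hφ
    have h2 := hab
    simp only [color] at h2
    have h3 := congrArg (Multiset.map fun t : Fin k → Color k C m => fun j => φ (t j))
      (Prod.mk.inj h2).2
    simp only [Multiset.map_map, Function.comp_def, hφ] at h3
    change (color γ (m + 1) a, _) = (color γ (m + 1) b, _)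
    rw [hab, h3]
  have up : ∀ d, (∀ a b : Fin k → G, color γ (n + d) a = color γ (n + d) b →
      color γ (n + d + 1) a = color γ (n + d + 1) b) := by
    intro d
    induction d with
    | zero => exact hn
    | succ d ih => exact step _ ih
  constructor
  · intro hs
    exact congrFun hs n
  · intro hs
    have above : ∀ d, color γ (n + d) g = color γ (n + d) h := by
      intro d
      induction d with
      | zero => exact hs
      | succ d ih => exact up d _ _ ih
    have below : ∀ d m, color γ (m + d) g = color γ (m + d) h → color γ m g = color γ m h := by
      intro d
      induction d with
      | zero => exact fun m hm => hm
      | succ d ih => exact fun m hm => ih m (down _ _ _ hm)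
    funext m
    refine below n m ?_
    rw [Nat.add_comm m n]
    exact above m

/-- The induced coloring of group elements: the stable color of `(x, 1, …, 1)`. -/
noncomputable def elementColor (k : ℕ) {G : Type u} [Group G] [Finite G] {C : Type w} (γ : G → C)
    (x : G) : (n : ℕ) → Color k C n :=
  stableColor γ fun j : Fin k => if j.val = 0 then x else 1

/-- `(G, γ)` and `(H, δ)` are not distinguished by `k`-WL of Version I. -/
def ColoredEquiv (k : ℕ) {G : Type u} [Group G] [Finite G] {H : Type v} [Group H] [Finite H]
    {C : Type w} (γ : G → C) (δ : H → C) : Prop :=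
  ∃ f : (Fin k → G) ≃ (Fin k → H), ∀ g, stableColor γ g = stableColor δ (f g)

/-- The (uncolored) groups `G` and `H` are not distinguished by `k`-WL of Version I: all
elements get the same color. -/
def Indist (k : ℕ) (G : Type u) [Group G] [Finite G] (H : Type v) [Group H] [Finite H] : Prop :=
  ColoredEquiv k (fun _ : G => ()) (fun _ : H => ())

/-- A subset selector assigns to every finite colored group a subset of the group. -/
def SubsetSelector : Type (max (u + 1) (w + 1)) :=
  ∀ (G : Type u) [Group G] [Finite G] {C : Type w}, (G → C) → Set G

/-- Detectability of a subset selector by `k`-WL of Version I: the colors on the selected subset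
of any colored group do not occur on the complement of the selected subset of any colored group. -/
def Detectable (k : ℕ) (S : SubsetSelector.{u, w}) : Prop :=
  ∀ (G : Type u) [Group G] [Finite G] (H : Type u) [Group H] [Finite H] (C : Type w)
    (γ : G → C) (δ : H → C),
    elementColor k γ '' S G γ ∩ elementColor k δ '' (S H δ)ᶜ = ∅

/-- The subset selector given by the `i`-th term of the upper central series. -/
def upperCentralSelector (i : ℕ) : SubsetSelector.{u, w} :=
  fun G _ _ _ _ => (Subgroup.upperCentralSeries G i : Set G)

/-- The factor `Z^(i+1)(G) / Z^i(G)` of the upper central series. -/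
abbrev UpperCentralFactor (G : Type u) [Group G] (i : ℕ) : Type u :=
  Subgroup.upperCentralSeries G (i + 1) ⧸
    (Subgroup.upperCentralSeries G i).subgroupOf (Subgroup.upperCentralSeries G (i + 1))

end GroupWL

/-! Equality of stable colors is a bijective pebble game: tuples of equal color extend
simultaneously along one bijection of the groups (`exists_equiv_update`), and any relation with this
property that respects initial colors preserves stable colors (`stableColor_eq_of_bisimulation`). A
product written into a spare coordinate is matched by the corresponding product. Four coordinates
hold `x`, `w`, `x * w`, `w * x`, so commutators can be compared, and induction along the upper
central series gives detectability.

Detected subgroups inherit the game by restriction. For quotients the game bijection need not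
respect cosets, but fibres of equal size and Hall's theorem give a bijection of cosets agreeing with
it on some representatives; membership in the subgroup is detected, so any representatives will do.
Applied to the central factors, this bijection preserves which powers are trivial, and that
determines a finite abelian group. -/

/-! ### Finite abelian groups are determined by their torsion counts. -/

section AbelianHoms

variable {A : Type u} [AddCommGroup A] {B : Type v} [AddCommGroup B]

/-- Homomorphisms with kernel `N` correspond to injective homomorphisms from the quotient. -/
def homsWithKerEquiv {K : Type w} [AddCommGroup K] (N : AddSubgroup K) :
    {f : K →+ A // f.ker = N} ≃ {f : K ⧸ N →+ A // f.ker = ⊥} where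
  toFun f := ⟨QuotientAddGroup.lift N f.1 f.2.ge, by
    rw [eq_bot_iff]
    intro x
    induction x using QuotientAddGroup.induction_on with
    | H x =>
      intro hx
      have : x ∈ f.1.ker := hx
      rw [f.2] at this
      exact (QuotientAddGroup.eq_zero_iff x).2 this⟩
  invFun f := ⟨f.1.comp (QuotientAddGroup.mk' N), by
    rw [← AddMonoidHom.comap_ker, f.2, AddMonoidHom.comap_bot, QuotientAddGroup.ker_mk']⟩
  left_inv f := by ext; rfl
  right_inv f := by
    apply Subtype.ext
    ext x
    rfl

theorem card_homs_eq_sum {K : Type w} [AddCommGroup K] [Finite K] [Finite A]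
    [Fintype (AddSubgroup K)] :
    Nat.card (K →+ A) = ∑ N : AddSubgroup K, Nat.card {f : K →+ A // f.ker = N} := by
  have : Finite (K →+ A) := DFunLike.finite _
  rw [← Nat.card_sigma, Nat.card_congr (Equiv.sigmaFiberEquiv fun f : K →+ A => f.ker)]

/-- If two finite abelian groups receive equally many homomorphisms from each finite abelian
group, then they receive equally many injective ones. -/
theorem card_injective_homs_eq [Finite A] [Finite B]
    (h : ∀ (K : Type w) [AddCommGroup K] [Finite K], Nat.card (K →+ A) = Nat.card (K →+ B))
    (K : Type w) [AddCommGroup K] [Finite K] :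
    Nat.card {f : K →+ A // f.ker = ⊥} = Nat.card {f : K →+ B // f.ker = ⊥} := by
  classical
  induction hn : Nat.card K using Nat.strong_induction_on generalizing K with
  | _ n ih =>
    subst hn
    let _ := Fintype.ofFinite (AddSubgroup K)
    have h1 := h K
    rw [card_homs_eq_sum, card_homs_eq_sum, ← Finset.add_sum_erase _ _ (Finset.mem_univ ⊥),
      ← Finset.add_sum_erase (a := (⊥ : AddSubgroup K)) _
        (fun N => Nat.card {f : K →+ B // f.ker = N}) (Finset.mem_univ ⊥)] at h1
    -- Nonzero kernels contribute injective homs from smaller quotients, equal in number by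
    -- induction, so they cancel.
    refine Nat.add_right_cancel (h1.trans ?_)
    congr 1
    refine Finset.sum_congr rfl fun N hN => ?_
    rw [Nat.card_congr (homsWithKerEquiv N), Nat.card_congr (homsWithKerEquiv N)]
    refine (ih _ ?_ (K ⧸ N) rfl).symm
    have hN1 : 1 < Nat.card N := by
      have := Finset.ne_of_mem_erase hN
      have h2 : Nat.card N ≠ 1 := fun h => this (AddSubgroup.card_eq_one.1 h)
      have h3 : 0 < Nat.card N := Nat.card_pos
      omega
    rw [AddSubgroup.card_eq_card_quotient_mul_card_addSubgroup N]
    exact lt_mul_of_one_lt_right Nat.card_pos hN1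

/-- `K` is a direct sum of cyclic groups, and a hom from `ZMod n` is an element killed by `n`. -/
theorem card_homs_eq_of_torsion (e : ∀ n : ℕ, Nonempty ({a : A // n • a = 0} ≃ {b : B // n • b = 0}))
    (K : Type w) [AddCommGroup K] [Finite K] : Nat.card (K →+ A) = Nat.card (K →+ B) := by
  classical
  obtain ⟨ι, _, n, -, ⟨φ⟩⟩ := AddCommGroup.equiv_directSum_zmod_of_finite' K
  have cyc : ∀ i, Nonempty ((ZMod (n i) →+ A) ≃ (ZMod (n i) →+ B)) := by
    intro i
    refine (e (n i)).map fun t => ?_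
    refine ((ZMod.lift (n i)).symm.trans ?_).trans (ZMod.lift (n i))
    refine (Equiv.subtypeEquiv (zmultiplesHom A).symm ?_).trans
      (t.trans (Equiv.subtypeEquiv (zmultiplesHom B).symm ?_).symm)
    · intro f
      simp [zmultiplesHom, ← map_nsmul]
    · intro f
      simp [zmultiplesHom, ← map_nsmul]
  refine Nat.card_congr ?_
  exact (φ.addMonoidHomCongrLeftEquiv).trans
    ((DFinsupp.liftAddHom.symm.toEquiv.trans
      (Equiv.piCongrRight fun i => (cyc i).some)).trans
    (DFinsupp.liftAddHom.toEquiv.trans φ.symm.addMonoidHomCongrLeftEquiv))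

/-- Finite abelian groups with equally many elements of each exponent are isomorphic. -/
theorem nonempty_addEquiv_of_torsion [Finite A] [Finite B]
    (e : ∀ n : ℕ, Nonempty ({a : A // n • a = 0} ≃ {b : B // n • b = 0})) :
    Nonempty (A ≃+ B) := by
  -- Testing with `K = A`, the identity of `A` forces an injective hom `A →+ B` to exist.
  have h1 := card_injective_homs_eq (card_homs_eq_of_torsion e) A
  have : Finite (A →+ B) := DFunLike.finite _
  have : Finite (A →+ A) := DFunLike.finite _
  have : Nonempty {f : A →+ A // f.ker = ⊥} :=
    ⟨⟨AddMonoidHom.id A, (AddMonoidHom.ker_eq_bot_iff _).2 Function.injective_id⟩⟩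
  have h2 : 0 < Nat.card {f : A →+ A // f.ker = ⊥} := Nat.card_pos
  rw [h1] at h2
  obtain ⟨f, hf⟩ := (Nat.card_pos_iff.1 h2).1
  have hinj := (AddMonoidHom.ker_eq_bot_iff _).1 hf
  have hcard : Nat.card A = Nat.card B := by
    -- This exponent kills both groups, so the torsion bijection is one between the whole groups.
    obtain ⟨t⟩ := e (Nat.card A * Nat.card B)
    rw [← Nat.card_congr (Equiv.subtypeUnivEquiv fun a : A => by
        rw [mul_comm, mul_nsmul', card_nsmul_eq_zero', nsmul_zero] :
        {a : A // (Nat.card A * Nat.card B) • a = 0} ≃ A), Nat.card_congr t,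
      Nat.card_congr (Equiv.subtypeUnivEquiv fun b : B => by
        rw [mul_nsmul', card_nsmul_eq_zero', nsmul_zero])]
  exact ⟨AddEquiv.ofBijective f ((Nat.bijective_iff_injective_and_card f).2 ⟨hinj, hcard⟩)⟩

end AbelianHoms

/-- Finite commutative groups with a bijection respecting exponents are isomorphic. -/
theorem nonempty_mulEquiv_of_pow_eq_one_iff {A : Type u} [Group A] [Finite A] {B : Type v} [Group B]
    [Finite B] (hA : ∀ x y : A, x * y = y * x) (hB : ∀ x y : B, x * y = y * x) (F : A ≃ B)
    (hF : ∀ x (n : ℕ), x ^ n = 1 ↔ F x ^ n = 1) : Nonempty (A ≃* B) := by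
  let _ : CommGroup A := { ‹Group A› with mul_comm := hA }
  let _ : CommGroup B := { ‹Group B› with mul_comm := hB }
  obtain ⟨φ⟩ := nonempty_addEquiv_of_torsion (A := Additive A) (B := Additive B) fun n =>
    ⟨Equiv.subtypeEquiv (Additive.toMul.trans (F.trans Additive.ofMul)) fun a => hF a.toMul n⟩
  exact ⟨MulEquiv.toAdditive.symm φ⟩

/-! ### Descending a bijection to quotients by Hall's theorem. -/

section Matching

theorem card_filter_mem_eq_mul {A A' : Type*} [Fintype A] [DecidableEq A'] (p : A → A') {d : ℕ}
    (hp : ∀ a', Nat.card {a // p a = a'} = d) (S : Finset A') :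
    (Finset.univ.filter fun a => p a ∈ S).card = S.card * d := by
  rw [Finset.card_eq_sum_card_fiberwise (f := p) (t := S) (fun a ha => by simpa using ha)]
  refine Finset.sum_const_nat fun a' ha' => ?_
  rw [← hp a', Nat.card_eq_fintype_card, Fintype.card_subtype, Finset.filter_filter]
  congr 1
  ext a
  simp only [Finset.mem_filter, Finset.mem_univ, true_and, and_iff_right_iff_imp]
  rintro rfl
  exact ha'

/-- A bijection between finite sets induces, for maps whose fibres all have the same size, a
bijection of the targets which is compatible with some choice of representatives. -/
theorem exists_equiv_of_card_fiber {A A' B B' : Type*} [Finite A] [Finite A'] [Finite B]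
    [Finite B'] (p : A → A') (q : B → B') {d : ℕ} (hd : 0 < d)
    (hp : ∀ a', Nat.card {a // p a = a'} = d) (hq : ∀ b', Nat.card {b // q b = b'} = d)
    (e : A ≃ B) : ∃ F : A' ≃ B', ∀ a', ∃ a, p a = a' ∧ q (e a) = F a' := by
  classical
  let _ := Fintype.ofFinite A
  let _ := Fintype.ofFinite A'
  let _ := Fintype.ofFinite B
  let _ := Fintype.ofFinite B'
  have cp := card_filter_mem_eq_mul p hp
  have cq := card_filter_mem_eq_mul q hq
  -- Hall's condition: `e` sends the `d * |S|` points over `S` into the points over the neighbours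
  -- of `S`, and each neighbour has only `d` points over it.
  obtain ⟨F, hinj, hF⟩ := (Fintype.all_card_le_filter_rel_iff_exists_injective
    fun a' b' => ∃ a, p a = a' ∧ q (e a) = b').1 (by
      intro S
      refine Nat.le_of_mul_le_mul_right ?_ hd
      rw [← cp, ← cq]
      refine Finset.card_le_card_of_injOn e ?_ e.injective.injOn
      intro a ha
      simp only [Finset.coe_filter, Finset.mem_univ, true_and, Set.mem_ofPred_eq,
        Finset.mem_filter] at ha ⊢
      exact ⟨_, ha, a, rfl, rfl⟩)
  have hcard : Fintype.card A' = Fintype.card B' := by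
    refine Nat.eq_of_mul_eq_mul_right hd ?_
    have h1 := cp Finset.univ
    have h2 := cq Finset.univ
    simp only [Finset.mem_univ, Finset.filter_true, Finset.card_univ] at h1 h2
    rw [← h1, ← h2, Fintype.card_congr e]
  exact ⟨Equiv.ofBijective F ((Fintype.bijective_iff_injective_and_card F).2 ⟨hinj, hcard⟩), hF⟩

theorem exists_equiv_of_surjective {A A' B B' : Type*} [Group A] [Group A'] [Group B] [Group B']
    [Finite A] [Finite B] (φ : A →* A') (ψ : B →* B') (hφ : Function.Surjective φ)
    (hψ : Function.Surjective ψ) (hc : Nat.card φ.ker = Nat.card ψ.ker) (e : A ≃ B) :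
    ∃ F : A' ≃ B', ∀ a', ∃ a, φ a = a' ∧ ψ (e a) = F a' := by
  have := Finite.of_surjective φ hφ
  have := Finite.of_surjective ψ hψ
  refine exists_equiv_of_card_fiber φ ψ (d := Nat.card φ.ker) Nat.card_pos (fun a => ?_)
    (fun b => ?_) e
  · exact Nat.card_congr (MonoidHom.fiberEquivKerOfSurjective hφ a)
  · rw [hc]
    exact Nat.card_congr (MonoidHom.fiberEquivKerOfSurjective hψ b)

end Matching

namespace GroupWL

/-! ### The pebble game and what stable colors determine. -/

section Basic

variable {G : Type u} [Group G] [Finite G] {H : Type v} [Group H] [Finite H] {C : Type w} {k : ℕ}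
  {γ : G → C} {δ : H → C}

/-- Two maps with the same multiset of values differ by a bijection of their domains. -/
theorem exists_equiv_of_map_univ_eq {α : Type u} {β : Type v} [Fintype α] [Fintype β] {X : Type w}
    {f : α → X} {g : β → X} (h : Finset.univ.val.map f = Finset.univ.val.map g) :
    ∃ e : α ≃ β, ∀ a, f a = g (e a) := by
  classical
  have hc : ∀ x, Nonempty ({a // f a = x} ≃ {b // g b = x}) := by
    intro x
    refine Fintype.card_eq.1 ?_
    have h1 := congrArg (Multiset.count x) h
    simp only [Multiset.count_map] at h1
    rw [Fintype.card_subtype, Fintype.card_subtype]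
    simpa [Finset.card, Finset.filter, eq_comm] using h1
  let e : α ≃ β := (Equiv.sigmaFiberEquiv f).symm.trans
    ((Equiv.sigmaCongrRight fun x => (hc x).some).trans (Equiv.sigmaFiberEquiv g))
  exact ⟨e, fun a => (((hc (f a)).some ⟨a, rfl⟩).2).symm⟩

theorem color_eq_of_le {m n : ℕ} (hmn : m ≤ n) {g : Fin k → G} {h : Fin k → H}
    (e : color γ n g = color δ n h) : color γ m g = color δ m h := by
  induction hmn with
  | refl => exact e
  | step _ ih => exact ih (Prod.mk.inj e).1

/-- Tuples of the same stable color can be extended simultaneously: the forth-and-back property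
of the bijective pebble game. -/
theorem exists_equiv_update {g : Fin k → G} {h : Fin k → H}
    (e : stableColor γ g = stableColor δ h) :
    ∃ f : G ≃ H, ∀ x j,
      stableColor γ (Function.update g j x) = stableColor δ (Function.update h j (f x)) := by
  have h1 : ∀ n, ∃ f : G ≃ H, ∀ x j,
      color γ n (Function.update g j x) = color δ n (Function.update h j (f x)) := by
    intro n
    obtain ⟨f, hf⟩ := @exists_equiv_of_map_univ_eq G H (Fintype.ofFinite G) (Fintype.ofFinite H)
      _ _ _ (Prod.mk.inj (congrFun e (n + 1))).2
    exact ⟨f, fun x j => congrFun (hf x) j⟩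
  choose F hF using h1
  -- There are finitely many bijections, so one serves infinitely many rounds, hence all of them, as
  -- later colors determine earlier ones.
  obtain ⟨f, hf⟩ := Finite.exists_infinite_fiber F
  refine ⟨f, fun x j => funext fun n => ?_⟩
  obtain ⟨m, hm, hnm⟩ := (Set.infinite_coe_iff.1 hf).exists_gt n
  have hm' : F m = f := hm
  subst hm'
  exact color_eq_of_le hnm.le (hF m x j)

/-- A relation which respects initial colors and has the forth-and-back property relates only
tuples of the same stable color. -/
theorem stableColor_eq_of_bisimulation (R : (Fin k → G) → (Fin k → H) → Prop)
    (h0 : ∀ g h, R g h → color γ 0 g = color δ 0 h)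
    (hs : ∀ g h, R g h → ∃ f : G ≃ H, ∀ x j, R (Function.update g j x) (Function.update h j (f x)))
    {g : Fin k → G} {h : Fin k → H} (hR : R g h) : stableColor γ g = stableColor δ h := by
  have key : ∀ n g h, R g h → color γ n g = color δ n h := by
    intro n
    induction n with
    | zero => exact h0
    | succ n ih =>
      intro g h hR
      obtain ⟨f, hf⟩ := hs g h hR
      refine Prod.ext (ih g h hR) ?_
      let _ := Fintype.ofFinite G
      let _ := Fintype.ofFinite H
      change Finset.univ.val.map _ = Finset.univ.val.map _
      rw [← Finset.map_univ_equiv f, Finset.map_val, Multiset.map_map]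
      exact Multiset.map_congr rfl fun x _ => funext fun j => ih _ _ (hf x j)
  exact funext fun n => key n g h hR

theorem color_zero_eq_iff {g : Fin k → G} {h : Fin k → H} :
    color γ 0 g = color δ 0 h ↔ (∀ i, γ (g i) = δ (h i)) ∧ (∀ i j, g i = g j ↔ h i = h j) ∧
      ∀ i j m, g i * g j = g m ↔ h i * h j = h m := by
  refine Prod.ext_iff.trans (and_congr funext_iff (Prod.ext_iff.trans (and_congr ?_ ?_)))
  · exact ⟨fun e i j => iff_of_eq (congrFun (congrFun e i) j),
      fun e => funext fun i => funext fun j => propext (e i j)⟩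
  · exact ⟨fun e i j m => iff_of_eq (congrFun (congrFun (congrFun e i) j) m),
      fun e => funext fun i => funext fun j => funext fun m => propext (e i j m)⟩

section Definable

variable {g : Fin k → G} {h : Fin k → H}

theorem apply_eq_iff (e : stableColor γ g = stableColor δ h) (i j : Fin k) :
    g i = g j ↔ h i = h j :=
  (color_zero_eq_iff.1 (congrFun e 0)).2.1 i j

theorem mul_eq_iff (e : stableColor γ g = stableColor δ h) (i j m : Fin k) :
    g i * g j = g m ↔ h i * h j = h m :=
  (color_zero_eq_iff.1 (congrFun e 0)).2.2 i j m

/-- The identity is the only idempotent of a group. -/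
theorem apply_eq_one_iff (e : stableColor γ g = stableColor δ h) (i : Fin k) :
    g i = 1 ↔ h i = 1 := by
  simpa using mul_eq_iff e i i i

theorem exists_update (e : stableColor γ g = stableColor δ h) (j : Fin k) (x : G) :
    ∃ y, stableColor γ (Function.update g j x) = stableColor δ (Function.update h j y) :=
  let ⟨f, hf⟩ := exists_equiv_update e
  ⟨f x, hf x j⟩

theorem update_apply_eq (e : stableColor γ g = stableColor δ h) (j i : Fin k) :
    stableColor γ (Function.update g j (g i)) = stableColor δ (Function.update h j (h i)) := by
  by_cases hij : i = j
  · subst hij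
    simpa using e
  obtain ⟨y, hy⟩ := exists_update e j (g i)
  have h1 : h i = y := by simpa [hij] using apply_eq_iff hy i j
  rwa [h1]

theorem update_one_eq (e : stableColor γ g = stableColor δ h) (j : Fin k) :
    stableColor γ (Function.update g j 1) = stableColor δ (Function.update h j 1) := by
  obtain ⟨y, hy⟩ := exists_update e j 1
  have h1 : y = 1 := by simpa using apply_eq_one_iff hy j
  rwa [h1] at hy

theorem update_mul_eq (e : stableColor γ g = stableColor δ h) {l i j : Fin k} (hi : i ≠ l)
    (hj : j ≠ l) :
    stableColor γ (Function.update g l (g i * g j)) =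
      stableColor δ (Function.update h l (h i * h j)) := by
  obtain ⟨y, hy⟩ := exists_update e l (g i * g j)
  have h1 : h i * h j = y := by simpa [hi, hj] using mul_eq_iff hy i j l
  rwa [h1]

theorem update_mul_inv_eq (e : stableColor γ g = stableColor δ h) {l i j : Fin k} (hi : i ≠ l)
    (hj : j ≠ l) :
    stableColor γ (Function.update g l (g i * (g j)⁻¹)) =
      stableColor δ (Function.update h l (h i * (h j)⁻¹)) := by
  obtain ⟨y, hy⟩ := exists_update e l (g i * (g j)⁻¹)
  have h1 : y * h j = h i := by simpa [hi, hj] using mul_eq_iff hy l j i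
  rwa [← h1, mul_inv_cancel_right]

theorem ite_mem_insert_one_eq {X : Type w} [One X] (t : Fin k → X) (a : Fin k)
    (s : Finset (Fin k)) : (fun j => if j ∈ insert a s then 1 else t j) =
      Function.update (fun j => if j ∈ s then 1 else t j) a 1 := by
  ext j
  by_cases hj : j = a <;> simp [hj]

theorem ite_val_eq_zero_eq {X : Type w} [One X] (t : Fin k → X) (i : Fin k) :
    (fun j => if j ∈ Finset.univ.filter (fun j : Fin k => j.val ≠ 0) then 1
      else Function.update t ⟨0, i.pos⟩ (t i) j) = fun j => if j.val = 0 then t i else 1 := by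
  ext j
  by_cases hj : j.val = 0 <;> simp [Function.update_apply, hj, Fin.ext_iff]

theorem ite_one_eq (e : stableColor γ g = stableColor δ h) (s : Finset (Fin k)) :
    stableColor γ (fun j => if j ∈ s then 1 else g j) =
      stableColor δ (fun j => if j ∈ s then 1 else h j) := by
  induction s using Finset.induction_on with
  | empty => simpa using e
  | insert a s _ ih =>
    rw [ite_mem_insert_one_eq, ite_mem_insert_one_eq]
    exact update_one_eq ih a

/-- The stable color of a tuple determines the colors of its entries. -/
theorem elementColor_apply_eq (e : stableColor γ g = stableColor δ h) (i : Fin k) :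
    elementColor k γ (g i) = elementColor k δ (h i) := by
  -- Copying entry `i` to coordinate 0 and resetting all others to 1 gives the tuple that defines
  -- `elementColor`.
  have h1 := ite_one_eq (update_apply_eq e ⟨0, i.pos⟩ i) (Finset.univ.filter fun j => j.val ≠ 0)
  rwa [ite_val_eq_zero_eq, ite_val_eq_zero_eq] at h1

end Definable

/-- The stable color of a tuple determines the colors of the quotients of its entries. -/
theorem elementColor_mul_inv_eq (hk : 2 < k) {g : Fin k → G} {h : Fin k → H}
    (e : stableColor γ g = stableColor δ h) (i j : Fin k) :
    elementColor k γ (g i * (g j)⁻¹) = elementColor k δ (h i * (h j)⁻¹) := by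
  obtain ⟨l, hl⟩ := Finset.exists_mem_notMem_of_card_lt_card
    (s := ({i, j} : Finset (Fin k))) (t := Finset.univ)
    (Finset.card_le_two.trans_lt (by simpa using hk))
  simp only [Finset.mem_univ, Finset.mem_insert, Finset.mem_singleton, not_or, true_and] at hl
  simpa using elementColor_apply_eq (update_mul_inv_eq e (Ne.symm hl.1) (Ne.symm hl.2)) l

/-- With `k ≥ 4` some coordinate avoids `i`, `j`, `m`; it holds the product while `m` is still
available. -/
theorem elementColor_mul_mul_inv_eq (hk : 4 ≤ k) {g : Fin k → G} {h : Fin k → H}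
    (e : stableColor γ g = stableColor δ h) (i j m : Fin k) :
    elementColor k γ (g i * g j * (g m)⁻¹) = elementColor k δ (h i * h j * (h m)⁻¹) := by
  obtain ⟨l, hl⟩ := Finset.exists_mem_notMem_of_card_lt_card
    (s := ({i, j, m} : Finset (Fin k))) (t := Finset.univ)
    (Finset.card_le_three.trans_lt (by simpa using (by omega : 3 < k)))
  simp only [Finset.mem_univ, Finset.mem_insert, Finset.mem_singleton, not_or, true_and] at hl
  have hm := Ne.symm hl.2.2
  simpa [hm] using elementColor_mul_inv_eq (by omega)
    (update_mul_eq e (Ne.symm hl.1) (Ne.symm hl.2.1)) l m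

theorem elementColor_pow_eq (hk : 3 ≤ k) {x : G} {y : H}
    (e : elementColor k γ x = elementColor k δ y) (m : ℕ) :
    elementColor k γ (x ^ m) = elementColor k δ (y ^ m) := by
  let i0 : Fin k := ⟨0, by omega⟩
  let i1 : Fin k := ⟨1, by omega⟩
  let i2 : Fin k := ⟨2, by omega⟩
  have h01 : i0 ≠ i1 := by simp [i0, i1]
  have h02 : i0 ≠ i2 := by simp [i0, i2]
  have h12 : i1 ≠ i2 := by simp [i1, i2]
  suffices ∃ (g : Fin k → G) (h : Fin k → H), stableColor γ g = stableColor δ h ∧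
      g i0 = x ∧ h i0 = y ∧ g i1 = x ^ m ∧ h i1 = y ^ m by
    obtain ⟨g, h, e', -, -, hg, hh⟩ := this
    simpa [hg, hh] using elementColor_apply_eq e' i1
  induction m with
  | zero => exact ⟨_, _, e, by simp [i0], by simp [i0], by simp [i1], by simp [i1]⟩
  | succ m ih =>
    obtain ⟨g, h, e', hg0, hh0, hg1, hh1⟩ := ih
    -- Coordinate 2 is scratch space for `x ^ m * x`, which is then copied to coordinate 1.
    refine ⟨_, _, update_apply_eq (update_mul_eq e' h12 h02) i1 i2, ?_⟩
    simp [h01, h02, hg0, hh0, hg1, hh1, pow_succ]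

theorem mem_upperCentralSeries_of_elementColor_eq (hk : 4 ≤ k) (n : ℕ) {x : G} {y : H}
    (e : elementColor k γ x = elementColor k δ y) (hx : x ∈ Subgroup.upperCentralSeries G n) :
    y ∈ Subgroup.upperCentralSeries H n := by
  let i0 : Fin k := ⟨0, by omega⟩
  let i1 : Fin k := ⟨1, by omega⟩
  let i2 : Fin k := ⟨2, by omega⟩
  let i3 : Fin k := ⟨3, by omega⟩
  have h01 : i0 ≠ i1 := by simp [i0, i1]
  have h02 : i0 ≠ i2 := by simp [i0, i2]
  have h03 : i0 ≠ i3 := by simp [i0, i3]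
  have h12 : i1 ≠ i2 := by simp [i1, i2]
  have h13 : i1 ≠ i3 := by simp [i1, i3]
  have h23 : i2 ≠ i3 := by simp [i2, i3]
  induction n generalizing x y with
  | zero =>
    simp only [Subgroup.upperCentralSeries_zero, Subgroup.mem_bot] at hx ⊢
    simpa [i0, hx] using apply_eq_one_iff e i0
  | succ n ih =>
    rw [Subgroup.mem_upperCentralSeries_succ_iff] at hx ⊢
    intro z
    obtain ⟨w, e1⟩ := exists_update e.symm i1 z
    -- Coordinates 2 and 3 receive `x * w` and `w * x`, whose quotient is the commutator of `x` and
    -- `w`.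
    have e2 := update_mul_eq (update_mul_eq e1.symm (l := i2) (i := i0) (j := i1) h02 h12)
      (l := i3) (i := i1) (j := i0) h13 h03
    have e3 := elementColor_mul_inv_eq (by omega) e2 i2 i3
    have hi0 : i0.val = 0 := rfl
    simp only [ne_eq, h01, h02, h12, h23, not_false_eq_true, Function.update_of_ne,
      Function.update_self, hi0, if_true] at e3
    have := ih e3 (by simpa [commutatorElement_def, mul_assoc] using hx w)
    simpa [commutatorElement_def, mul_assoc] using this

theorem mem_upperCentralSeries_iff (hk : 4 ≤ k) (n : ℕ) {x : G} {y : H}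
    (e : elementColor k γ x = elementColor k δ y) :
    x ∈ Subgroup.upperCentralSeries G n ↔ y ∈ Subgroup.upperCentralSeries H n :=
  ⟨mem_upperCentralSeries_of_elementColor_eq hk n e,
    mem_upperCentralSeries_of_elementColor_eq hk n e.symm⟩

/-- Indistinguishable colored groups admit a bijection preserving the colors of elements. -/
theorem ColoredEquiv.exists_equiv_elementColor (hk : 0 < k) (e : ColoredEquiv k γ δ) :
    ∃ f : G ≃ H, ∀ x, elementColor k γ x = elementColor k δ (f x) := by
  obtain ⟨F, hF⟩ := e
  obtain ⟨f, hf⟩ := exists_equiv_update (hF 1)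
  exact ⟨f, fun x => by simpa using elementColor_apply_eq (hf x ⟨0, hk⟩) ⟨0, hk⟩⟩

end Basic

theorem detectable_upperCentralSelector {k : ℕ} (hk : 4 ≤ k) (i : ℕ) :
    Detectable k (upperCentralSelector.{u, w} i) := by
  intro G _ _ H _ _ C γ δ
  refine Set.eq_empty_iff_forall_notMem.2 ?_
  rintro _ ⟨⟨x, hx, rfl⟩, y, hy, hxy⟩
  exact hy ((mem_upperCentralSeries_iff hk i hxy.symm).1 hx)

end GroupWL

/-! ### Passage to subgroups, quotients and central factors. -/

namespace GroupWL

theorem coe_comp_update {k : ℕ} {X : Type u} {Y : Type v} (c : X → Y) (t : Fin k → X) (j : Fin k)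
    (x : X) :
    (fun i => c (Function.update t j x i)) = Function.update (fun i => c (t i)) j (c x) :=
  Function.comp_update c t j x

theorem card_ker_compLeft_mk' {G : Type u} [Group G] (N : Subgroup G) [N.Normal] (k : ℕ) :
    Nat.card (MonoidHom.compLeft (QuotientGroup.mk' N) (Fin k)).ker = Nat.card N ^ k := by
  have h1 : ∀ g : Fin k → G, g ∈ (MonoidHom.compLeft (QuotientGroup.mk' N) (Fin k)).ker ↔
      ∀ i, g i ∈ N := fun g => by
    rw [MonoidHom.mem_ker, funext_iff]
    exact forall_congr' fun i => QuotientGroup.eq_one_iff (g i)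
  rw [Nat.card_congr ((Equiv.subtypeEquivRight h1).trans
    (Equiv.subtypePiEquivPi (p := fun _ x => x ∈ N))), Nat.card_fun, Nat.card_fin]

section Passage

variable {G : Type u} [Group G] [Finite G] {H : Type v} [Group H] [Finite H] {k : ℕ}

theorem Indist.card_subgroup_eq (hk : 0 < k) (e : Indist k G H) (N : Subgroup G) (M : Subgroup H)
    (hNM : ∀ x y, elementColor k (fun _ : G => ()) x = elementColor k (fun _ : H => ()) y →
      (x ∈ N ↔ y ∈ M)) : Nat.card N = Nat.card M := by
  obtain ⟨f, hf⟩ := ColoredEquiv.exists_equiv_elementColor hk e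
  exact Nat.card_congr (Equiv.subtypeEquiv f fun x => hNM _ _ (hf x))

/-- Indistinguishability passes to subgroups which are detected by the colors of elements. -/
theorem Indist.subgroup (hk : 0 < k) (e : Indist k G H) (N : Subgroup G) (M : Subgroup H)
    (hNM : ∀ x y, elementColor k (fun _ : G => ()) x = elementColor k (fun _ : H => ()) y →
      (x ∈ N ↔ y ∈ M)) : Indist k N M := by
  obtain ⟨F, hF⟩ := e
  have hF' : ∀ g, (∀ i, g i ∈ N) ↔ ∀ i, F g i ∈ M := fun g =>
    forall_congr' fun i => hNM _ _ (elementColor_apply_eq (hF g) i)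
  let E : (Fin k → N) ≃ (Fin k → M) := (Equiv.subtypePiEquivPi (p := fun _ x => x ∈ N)).symm.trans
    ((Equiv.subtypeEquiv F hF').trans (Equiv.subtypePiEquivPi (p := fun _ x => x ∈ M)))
  refine ⟨E, fun g => stableColor_eq_of_bisimulation
    (fun (a : Fin k → N) (b : Fin k → M) => stableColor (fun _ : G => ()) (fun i => (a i : G)) =
      stableColor (fun _ : H => ()) fun i => (b i : H)) ?_ ?_ (hF fun i => (g i : G))⟩
  · intro a b hab
    refine color_zero_eq_iff.2 ⟨fun _ => rfl, fun i j => ?_, fun i j m => ?_⟩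
    · exact Subtype.ext_iff.trans ((apply_eq_iff hab i j).trans Subtype.ext_iff.symm)
    · rw [Subtype.ext_iff, Subtype.ext_iff]
      exact mul_eq_iff hab i j m
  · intro a b hab
    obtain ⟨f, hf⟩ := exists_equiv_update hab
    refine ⟨Equiv.subtypeEquiv f fun x => hNM _ _ ?_, fun x j => ?_⟩
    · simpa using elementColor_apply_eq (hf x ⟨0, hk⟩) ⟨0, hk⟩
    · simp only [coe_comp_update]
      exact hf x j

/-- Indistinguishability passes to quotients by normal subgroups which are detected by the colors
of elements. -/
theorem Indist.quotient (hk : 4 ≤ k) (e : Indist k G H) (N : Subgroup G) [N.Normal]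
    (M : Subgroup H) [M.Normal]
    (hNM : ∀ x y, elementColor k (fun _ : G => ()) x = elementColor k (fun _ : H => ()) y →
      (x ∈ N ↔ y ∈ M)) : Indist k (G ⧸ N) (H ⧸ M) := by
  have hcard := e.card_subgroup_eq (by omega) N M hNM
  obtain ⟨F, hF⟩ := e
  obtain ⟨E, hE⟩ := exists_equiv_of_surjective
    (MonoidHom.compLeft (QuotientGroup.mk' N) (Fin k))
    (MonoidHom.compLeft (QuotientGroup.mk' M) (Fin k))
    (QuotientGroup.mk'_surjective N).comp_left (QuotientGroup.mk'_surjective M).comp_left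
    (by rw [card_ker_compLeft_mk', card_ker_compLeft_mk', hcard]) F
  -- Tuples of cosets are related when some representatives have equal stable color.
  refine ⟨E, fun X => stableColor_eq_of_bisimulation
    (fun (X : Fin k → G ⧸ N) (Y : Fin k → H ⧸ M) => ∃ (g : Fin k → G) (h : Fin k → H),
      stableColor (fun _ : G => ()) g = stableColor (fun _ : H => ()) h ∧
      (fun i => (g i : G ⧸ N)) = X ∧ (fun i => (h i : H ⧸ M)) = Y) ?_ ?_ ?_⟩
  · rintro _ _ ⟨g, h, hgh, rfl, rfl⟩
    refine color_zero_eq_iff.2 ⟨fun _ => rfl, fun i j => ?_, fun i j m => ?_⟩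
    · have := hNM _ _ (elementColor_mul_inv_eq (by omega) hgh i j)
      rwa [← div_eq_mul_inv, ← div_eq_mul_inv, ← QuotientGroup.eq_iff_div_mem,
        ← QuotientGroup.eq_iff_div_mem] at this
    · have := hNM _ _ (elementColor_mul_mul_inv_eq hk hgh i j m)
      rwa [← div_eq_mul_inv, ← div_eq_mul_inv, ← QuotientGroup.eq_iff_div_mem,
        ← QuotientGroup.eq_iff_div_mem] at this
  · rintro _ _ ⟨g, h, hgh, rfl, rfl⟩
    obtain ⟨f, hf⟩ := exists_equiv_update hgh
    obtain ⟨f', hf'⟩ := exists_equiv_of_surjective (QuotientGroup.mk' N) (QuotientGroup.mk' M)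
      (QuotientGroup.mk'_surjective N) (QuotientGroup.mk'_surjective M)
      (by rw [QuotientGroup.ker_mk', QuotientGroup.ker_mk', hcard]) f
    refine ⟨f', fun x j => ?_⟩
    obtain ⟨a, rfl, ha⟩ := hf' x
    refine ⟨_, _, hf a j, ?_, ?_⟩
    · exact coe_comp_update _ g j a
    · rw [← ha]
      exact coe_comp_update _ h j (f a)
  · obtain ⟨g, rfl, hg⟩ := hE X
    exact ⟨g, F g, hF g, rfl, hg⟩

end Passage

theorem upperCentralFactor_mul_comm {G : Type u} [Group G] (i : ℕ) (x y : UpperCentralFactor G i) :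
    x * y = y * x := by
  induction x using QuotientGroup.induction_on with
  | H x =>
  induction y using QuotientGroup.induction_on with
  | H y =>
    rw [← QuotientGroup.mk_mul, ← QuotientGroup.mk_mul, QuotientGroup.eq_iff_div_mem,
      Subgroup.mem_subgroupOf]
    simpa [div_eq_mul_inv, mul_assoc, commutatorElement_def] using
      (Subgroup.mem_upperCentralSeries_succ_iff.1 x.2) (y : G)

theorem card_subgroupOf_upperCentralSeries {G : Type u} [Group G] (i : ℕ) :
    Nat.card ((Subgroup.upperCentralSeries G i).subgroupOf (Subgroup.upperCentralSeries G (i + 1))) =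
      Nat.card (Subgroup.upperCentralSeries G i) :=
  Nat.card_congr
    (Subgroup.subgroupOfEquivOfLe (Subgroup.upperCentralSeries_mono G i.le_succ)).toEquiv

/-- Corresponding factors of the upper central series of indistinguishable groups are isomorphic. -/
theorem Indist.nonempty_upperCentralFactor_mulEquiv {k : ℕ} (hk : 4 ≤ k) {G : Type u} [Group G]
    [Finite G] {H : Type v} [Group H] [Finite H] (e : Indist k G H) (i : ℕ) :
    Nonempty (UpperCentralFactor G i ≃* UpperCentralFactor H i) := by
  have hcard := e.card_subgroup_eq (by omega) _ _ fun _ _ => mem_upperCentralSeries_iff hk i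
  obtain ⟨f, hf⟩ := ColoredEquiv.exists_equiv_elementColor (by omega) e
  obtain ⟨F, hF⟩ := exists_equiv_of_surjective
    (QuotientGroup.mk' ((Subgroup.upperCentralSeries G i).subgroupOf
      (Subgroup.upperCentralSeries G (i + 1))))
    (QuotientGroup.mk' ((Subgroup.upperCentralSeries H i).subgroupOf
      (Subgroup.upperCentralSeries H (i + 1))))
    (QuotientGroup.mk'_surjective _) (QuotientGroup.mk'_surjective _)
    (by rw [QuotientGroup.ker_mk', QuotientGroup.ker_mk', card_subgroupOf_upperCentralSeries,
      card_subgroupOf_upperCentralSeries, hcard])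
    (Equiv.subtypeEquiv f fun x => mem_upperCentralSeries_iff hk (i + 1) (hf x))
  -- A power of a coset is trivial iff that power of a representative lies in `Z^i`, which its color
  -- detects.
  refine nonempty_mulEquiv_of_pow_eq_one_iff (upperCentralFactor_mul_comm i)
    (upperCentralFactor_mul_comm i) F fun X n => ?_
  obtain ⟨x, rfl, hx⟩ := hF X
  rw [← hx, ← map_pow, ← map_pow, QuotientGroup.mk'_apply, QuotientGroup.mk'_apply,
    QuotientGroup.eq_one_iff, QuotientGroup.eq_one_iff, Subgroup.mem_subgroupOf,
    Subgroup.mem_subgroupOf]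
  exact mem_upperCentralSeries_iff hk i (elementColor_pow_eq (by omega) (hf x) n)

end GroupWL

theorem mainTheorem6 (k : ℕ) (hk : 4 ≤ k) :
    (∀ i : ℕ, GroupWL.Detectable k (GroupWL.upperCentralSelector.{u, w} i)) ∧
    ∀ (G : Type u) [Group G] [Finite G] (H : Type v) [Group H] [Finite H],
      GroupWL.Indist k G H →
        ∀ i : ℕ,
          Nonempty (GroupWL.UpperCentralFactor G i ≃* GroupWL.UpperCentralFactor H i) ∧
          GroupWL.Indist k (Subgroup.upperCentralSeries G i) (Subgroup.upperCentralSeries H i) ∧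
          GroupWL.Indist k (G ⧸ Subgroup.upperCentralSeries G i)
            (H ⧸ Subgroup.upperCentralSeries H i) :=
  ⟨GroupWL.detectable_upperCentralSelector hk, fun _ _ _ _ _ _ e i =>
    ⟨e.nonempty_upperCentralFactor_mulEquiv hk i,
      e.subgroup (by omega) _ _ fun _ _ => GroupWL.mem_upperCentralSeries_iff hk i,
      e.quotient hk _ _ fun _ _ => GroupWL.mem_upperCentralSeries_iff hk i⟩⟩
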